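/- There is a universal constant $C>0$ such that the following holds. Let $k\ge 0$ be an integer, let $\varepsilon,\delta>0$, and put $N=\lfloor \varepsilon^{-2}\delta^{-1}\rfloor$. Let $G$ be a connected simple graph with $n>1$ vertices (finitely many), let $r$ be a vertex of $G$, and let $w_0=r,w_1,w_2,\dots$ be a simple random walk on $G$ started at $r$. Write $P_k(r,r)=\mathsf P(w_k=r)$. An observer sees only, at each time $t$, whether $w_t=r$. Put $S_0=0$ and, for $j\ge 0$, let $S_{j+1}$ be the first time $t\ge S_j+k$ at which $w_t=r$; the period from $S_j$ to $S_{j+1}$ is the $j$-th experiment, and it is called successful if $S_{j+1}=S_j+k$. Let $\hat p$ be the relative frequency of the successful experiments among the first $N$ of them ($\hat p=0$ if $N=0$). Then 1. $S_N$ and $\hat p$ are determined by what is observed up to time $S_N$ (in particular, the procedure depends on $k,\varepsilon,\delta$, but not on $G$, $n$ or $r$); 2. the events that the $j$-th experiment is successful, $j=0,1,2,\dots$, are independent, and each has probability $P_k(r,r)$; 3. the expected observation time satisfies $\mathsf E(S_N)\le C\,(k+n^3)\,\varepsilon^{-2}\delta^{-1}$; 4. $\mathsf P\bigl(|\hat p-P_k(r,r)|<\varepsilon\bigr)\ge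 1-\delta$. -/

import Mathlib

open MeasureTheory ProbabilityTheory
open scoped ENNReal

namespace ReturnObservation

/-- One-step transition probability of the simple random walk on `G`. -/
noncomputable def transitionProb {V : Type*} [Fintype V] (G : SimpleGraph V)
    [DecidableRel G.Adj] (x y : V) : ℝ≥0∞ :=
  if G.Adj x y then (G.degree x : ℝ≥0∞)⁻¹ else 0

/-- `w 0, w 1, w 2, …` is a simple random walk on `G` started at `r`: at every time, whatever the
past trajectory, the next position is a uniformly random neighbour of the current one. The
conditional probability is multiplied out, so that null trajectories need no convention. -/
structure IsSimpleRandomWalk {V Ω : Type*} [Fintype V] [MeasurableSpace Ω] (G : SimpleGraph V)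
    [DecidableRel G.Adj] (r : V) (P : Measure Ω) (w : ℕ → Ω → V) : Prop where
  measurableSet_eq : ∀ t v, MeasurableSet {ω | w t ω = v}
  start : ∀ᵐ ω ∂P, w 0 ω = r
  step : ∀ (m : ℕ) (x : ℕ → V),
    P {ω | ∀ i ≤ m + 1, w i ω = x i} =
      P {ω | ∀ i ≤ m, w i ω = x i} * transitionProb G (x m) (x (m + 1))

/-- What the observer sees: bit `t` tells whether the walk is at `r` at time `t`. -/
def observed {V Ω : Type*} [DecidableEq V] (r : V) (w : ℕ → Ω → V) (ω : Ω) : ℕ → Bool :=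
  fun t => decide (w t ω = r)

/-- The time at which the first `j` experiments are over. An experiment consists of waiting `k`
steps and then until the first time (that very moment included) at which a visit is observed; the
next experiment starts there. The value is `⊤` if some experiment never ends. -/
noncomputable def experimentEnd (k : ℕ) (a : ℕ → Bool) : ℕ → ℕ∞
  | 0 => 0
  | j + 1 => ⨅ (m : ℕ) (_ : experimentEnd k a j + (k : ℕ∞) ≤ (m : ℕ∞) ∧ a m = true), (m : ℕ∞)

/-- Experiment number `j` (counted from `0`) is successful if it lasts exactly `k` steps. -/
def Successful (k : ℕ) (a : ℕ → Bool) (j : ℕ) : Prop :=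
  experimentEnd k a j ≠ ⊤ ∧ experimentEnd k a (j + 1) = experimentEnd k a j + (k : ℕ∞)

open Classical in
/-- Relative frequency of the successful ones among the first `N` experiments
(it is `0` if `N = 0`). -/
noncomputable def estimate (k N : ℕ) (a : ℕ → Bool) : ℝ :=
  (((Finset.range N).filter (fun j => Successful k a j)).card : ℝ) / (N : ℝ)

/-- The number of experiments made for accuracy `ε` and confidence `1 - δ`. If it is `0`, then
`ε > 1` or `δ > 1`, and no observation is needed. -/
noncomputable def experimentCount (ε δ : ℝ) : ℕ := ⌊(ε ^ 2 * δ)⁻¹⌋₊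

end ReturnObservation

namespace ReturnObservation

/-! ### Energy bounds and hitting-time potentials. -/

section Potential

open scoped Matrix

variable {V : Type*} [Fintype V] [DecidableEq V] {G : SimpleGraph V} [DecidableRel G.Adj]

/-! Every experiment starts with the walk at `r`. The event `S_j = m` and the outcomes of the
earlier experiments are decided by time `m`, so the Markov property gives success probability
`P_k(r, r)` whatever happened before. Summing over `m` gives a product formula, hence independence
(`measure_biInter_insert`). This needs `S_j` to be finite almost surely, which follows from the
bound on its expectation.

For that bound, let `f` vanish at `r` and equal one plus the average over the neighbours elsewhere.
Its energy, summed over ordered adjacent pairs, is `2 ⟨f, L f⟩ ≤ 2 n² max f`. Cauchy–Schwarz along a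
path to `r` gives `(max f)² ≤ n · energy`, so `max f ≤ 2 n³`. Off `r` the mean of `f` drops by one
per step, so from any position the expected wait for `r` is at most `2 n³`
(`tsum_measure_forall_ne_le`), and an experiment lasts at most `k + 2 n³` on average.

Accuracy is Chebyshev's inequality with variance at most `1/4` per experiment; the factor `4` this
leaves pays for the floor in `N`. -/

theorem sum_mul_lapMatrix_mulVec (f : V → ℝ) :
    ∑ x, f x * (G.lapMatrix ℝ *ᵥ f) x =
      (∑ x, ∑ y, if G.Adj x y then (f x - f y) ^ 2 else 0) / 2 := by
  rw [← SimpleGraph.lapMatrix_toLinearMap₂', Matrix.toLinearMap₂'_apply']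
  rfl

/-- Effective resistances are at most the number of vertices. -/
theorem sq_sub_le_card_mul_energy (hG : G.Connected) (f : V → ℝ) (x y : V) :
    (f x - f y) ^ 2 ≤
      Fintype.card V * ∑ u, ∑ v, if G.Adj u v then (f u - f v) ^ 2 else 0 := by
  -- In a path the darts are distinct and fewer than the vertices, so their squared differences form
  -- part of the double sum.
  obtain ⟨p, hp⟩ := (hG x y).exists_isPath
  have telescope : ∀ {a b : V} (q : G.Walk a b),
      (q.darts.map fun d => f d.fst - f d.snd).sum = f a - f b := by
    intro a b q
    induction q with
    | nil => simp
    | cons h q ih => simp [ih]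
  have hnd : p.darts.Nodup := SimpleGraph.Walk.darts_nodup_of_support_nodup hp.support_nodup
  have hsum : f x - f y = ∑ d ∈ p.darts.toFinset, (f d.fst - f d.snd) := by
    rw [List.sum_toFinset _ hnd, telescope]
  have hcard : (p.darts.toFinset.card : ℝ) ≤ Fintype.card V := by
    have h := hp.length_lt
    rw [List.toFinset_card_of_nodup hnd, SimpleGraph.Walk.length_darts]
    exact_mod_cast h.le
  have hinj : Set.InjOn (fun d : G.Dart => (d.fst, d.snd)) (p.darts.toFinset : Set G.Dart) := by
    intro d _ e _ h
    exact SimpleGraph.Dart.ext _ _ h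
  have henergy : ∑ d ∈ p.darts.toFinset, (f d.fst - f d.snd) ^ 2 ≤
      ∑ u, ∑ v, if G.Adj u v then (f u - f v) ^ 2 else 0 := by
    rw [← Fintype.sum_prod_type' (f := fun u v => if G.Adj u v then (f u - f v) ^ 2 else 0)]
    calc ∑ d ∈ p.darts.toFinset, (f d.fst - f d.snd) ^ 2
        = ∑ d ∈ p.darts.toFinset,
            (fun z : V × V => if G.Adj z.1 z.2 then (f z.1 - f z.2) ^ 2 else 0)
              (d.fst, d.snd) :=
          Finset.sum_congr rfl fun d _ => by simp [d.adj]
      _ = ∑ z ∈ p.darts.toFinset.image (fun d : G.Dart => (d.fst, d.snd)),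
            if G.Adj z.1 z.2 then (f z.1 - f z.2) ^ 2 else 0 :=
          (Finset.sum_image (f := fun z : V × V =>
            if G.Adj z.1 z.2 then (f z.1 - f z.2) ^ 2 else 0) hinj).symm
      _ ≤ _ := Finset.sum_le_sum_of_subset_of_nonneg (Finset.subset_univ _)
          fun z _ _ => by split_ifs <;> positivity
  rw [hsum]
  calc _ ≤ (p.darts.toFinset.card : ℝ) * ∑ d ∈ p.darts.toFinset, (f d.fst - f d.snd) ^ 2 :=
        sq_sum_le_card_mul_sum_sq
    _ ≤ _ := mul_le_mul hcard henergy (Finset.sum_nonneg fun _ _ => sq_nonneg _) (by positivity)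

/-- The Dirichlet problem with one boundary vertex is solvable on a connected graph. -/
theorem exists_lapMatrix_mulVec_eq (hG : G.Connected) (r : V) (g : V → ℝ) :
    ∃ f : V → ℝ, f r = 0 ∧ ∀ x, x ≠ r → (G.lapMatrix ℝ *ᵥ f) x = g x := by
  -- A square system, so injectivity suffices: a function in the kernel has zero energy, hence is
  -- constant, and it vanishes at `r`.
  let T : (V → ℝ) →ₗ[ℝ] (V → ℝ) :=
    { toFun := fun f x => if x = r then f r else (G.lapMatrix ℝ *ᵥ f) x
      map_add' := fun f g => by
        ext x
        simp only [Matrix.mulVec_add, Pi.add_apply]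
        split_ifs <;> rfl
      map_smul' := fun c f => by
        ext x
        simp only [Matrix.mulVec_smul, Pi.smul_apply, RingHom.id_apply]
        split_ifs <;> rfl }
  have hT : ∀ f x, T f x = if x = r then f r else (G.lapMatrix ℝ *ᵥ f) x := fun _ _ => rfl
  have hinj : Function.Injective T := by
    rw [injective_iff_map_eq_zero]
    intro f hf
    have hfr : f r = 0 := by simpa [hT] using congrFun hf r
    have henergy : ∑ x, f x * (G.lapMatrix ℝ *ᵥ f) x = 0 := by
      refine Finset.sum_eq_zero fun x _ => ?_
      by_cases hx : x = r
      · simp [hx, hfr]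
      · have h := congrFun hf x
        rw [hT, if_neg hx] at h
        simp [h]
    rw [sum_mul_lapMatrix_mulVec] at henergy
    ext x
    have h := sq_sub_le_card_mul_energy hG f x r
    rw [(div_eq_zero_iff.1 henergy).resolve_right two_ne_zero, mul_zero, hfr, sub_zero] at h
    simpa using pow_eq_zero_iff two_ne_zero |>.1 (le_antisymm h (sq_nonneg _))
  obtain ⟨f, hf⟩ := LinearMap.injective_iff_surjective.1 hinj
    (fun x => if x = r then 0 else g x)
  refine ⟨f, by simpa [hT] using congrFun hf r, fun x hx => ?_⟩
  simpa [hT, hx] using congrFun hf x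

/-- The expected hitting times of `r` form a nonnegative potential, cubically bounded. -/
theorem exists_potential (hG : G.Connected) (hV : 1 < Fintype.card V) (r : V) :
    ∃ f : V → ℝ, (∀ x, 0 ≤ f x) ∧ (∀ x, f x ≤ 2 * (Fintype.card V : ℝ) ^ 3) ∧
      ∀ x, x ≠ r → G.degree x * f x = G.degree x + ∑ y ∈ G.neighborFinset x, f y := by
  obtain ⟨f, hfr, hf⟩ := exists_lapMatrix_mulVec_eq hG r fun x => (G.degree x : ℝ)
  have heq : ∀ x, x ≠ r →
      (G.degree x : ℝ) * f x = G.degree x + ∑ y ∈ G.neighborFinset x, f y := by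
    intro x hx
    have h := hf x hx
    rw [SimpleGraph.lapMatrix_mulVec_apply] at h
    linarith
  have : Nontrivial V := Fintype.one_lt_card_iff_nontrivial.1 hV
  have hnonneg : ∀ x, 0 ≤ f x := by
    -- Minimum principle: at a minimiser other than `r`, the value could not be one more than the
    -- average over the neighbours.
    obtain ⟨z, hz⟩ := Finite.exists_min f
    suffices z = r by
      intro x
      simpa [this, hfr] using hz x
    by_contra hzr
    have hd : (0 : ℝ) < G.degree z := by
      exact_mod_cast hG.preconnected.degree_pos_of_nontrivial z
    have h1 := heq z hzr
    have h2 : (G.degree z : ℝ) * f z ≤ ∑ y ∈ G.neighborFinset z, f y := by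
      rw [← SimpleGraph.card_neighborFinset_eq_degree, ← nsmul_eq_mul]
      exact Finset.card_nsmul_le_sum _ _ _ fun y _ => hz y
    linarith
  obtain ⟨z, hz⟩ := Finite.exists_max f
  refine ⟨f, hnonneg, fun x => (hz x).trans ?_, heq⟩
  have hsq := sq_sub_le_card_mul_energy hG f z r
  have henergy := sum_mul_lapMatrix_mulVec (G := G) f
  -- The Laplacian is not prescribed at `r`, but `f r = 0` kills that term; elsewhere it is a
  -- degree, below `n`.
  have hle : ∑ x, f x * (G.lapMatrix ℝ *ᵥ f) x ≤ (Fintype.card V : ℝ) ^ 2 * f z := by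
    calc ∑ x, f x * (G.lapMatrix ℝ *ᵥ f) x ≤ ∑ _x : V, (Fintype.card V : ℝ) * f z := by
          refine Finset.sum_le_sum fun x _ => ?_
          by_cases hx : x = r
          · subst hx
            rw [hfr, zero_mul]
            exact mul_nonneg (Nat.cast_nonneg _) (hnonneg z)
          · rw [hf x hx, mul_comm]
            refine mul_le_mul ?_ (hz x) (hnonneg x) (Nat.cast_nonneg _)
            exact_mod_cast (G.degree_lt_card_verts x).le
      _ = _ := by simp [sq, mul_assoc]
  rw [hfr, sub_zero] at hsq
  by_contra! hlt
  have hn : (0 : ℝ) ≤ Fintype.card V := Nat.cast_nonneg _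
  have hpos : 0 < f z := lt_of_le_of_lt (by positivity) hlt
  have h2 : (Fintype.card V : ℝ) * (∑ u, ∑ v, if G.Adj u v then (f u - f v) ^ 2 else 0) ≤
      Fintype.card V * (2 * ((Fintype.card V : ℝ) ^ 2 * f z)) :=
    mul_le_mul_of_nonneg_left (by linarith) hn
  have h3 : f z * f z ≤ 2 * (Fintype.card V : ℝ) ^ 3 * f z := by
    linarith [sq (f z), h2, hsq, pow_succ (Fintype.card V : ℝ) 2]
  exact absurd (le_of_mul_le_mul_right h3 hpos) (not_le.2 hlt)

end Potential

/-! ### Deterministic properties of the observed bit sequence. -/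

section Experiments

/-- The first visit observed at time `t` or later. -/
noncomputable def nextVisit (a : ℕ → Bool) (t : ℕ∞) : ℕ∞ :=
  ⨅ (m : ℕ) (_ : t ≤ (m : ℕ∞) ∧ a m = true), (m : ℕ∞)

variable {a a' : ℕ → Bool} {k : ℕ}

theorem experimentEnd_succ (k : ℕ) (a : ℕ → Bool) (j : ℕ) :
    experimentEnd k a (j + 1) = nextVisit a (experimentEnd k a j + k) := rfl

theorem nextVisit_le {t : ℕ∞} {m : ℕ} (h : t ≤ m) (hm : a m = true) : nextVisit a t ≤ m :=
  iInf₂_le m ⟨h, hm⟩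

theorem le_nextVisit (a : ℕ → Bool) (t : ℕ∞) : t ≤ nextVisit a t :=
  le_iInf₂ fun _ h => h.1

theorem nextVisit_eq_top {t : ℕ∞} (h : ∀ m : ℕ, t ≤ m → a m = false) : nextVisit a t = ⊤ := by
  simp only [nextVisit, iInf_eq_top]
  intro m hm
  simp [h m hm.1] at hm

/-- A finite value of `nextVisit` is attained. -/
theorem exists_nextVisit_eq {t : ℕ∞} (h : nextVisit a t ≠ ⊤) :
    ∃ m : ℕ, nextVisit a t = m ∧ t ≤ m ∧ a m = true := by
  classical
  have hex : ∃ m : ℕ, t ≤ m ∧ a m = true := by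
    by_contra! hne
    exact h (nextVisit_eq_top fun m hm => by simpa using hne m hm)
  refine ⟨Nat.find hex, le_antisymm ?_ ?_, Nat.find_spec hex⟩
  · exact nextVisit_le (Nat.find_spec hex).1 (Nat.find_spec hex).2
  · exact le_iInf₂ fun m hm => by exact_mod_cast Nat.find_min' hex hm

theorem nextVisit_eq_self_iff {m : ℕ} : nextVisit a m = m ↔ a m = true := by
  refine ⟨fun h => ?_, fun h => le_antisymm (nextVisit_le le_rfl h) (le_nextVisit _ _)⟩
  obtain ⟨n, hn, -, han⟩ := exists_nextVisit_eq (a := a) (t := m) (by simp [h])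
  rw [h] at hn
  rwa [Nat.cast_inj.1 hn]

/-- The stopping-time property: the visit attaining the value for `a` is also one for `a'`, and an
earlier visit of `a'` would fall in the range of agreement. -/
theorem nextVisit_congr {t : ℕ∞} (h : ∀ s : ℕ, (s : ℕ∞) ≤ nextVisit a t → a s = a' s) :
    nextVisit a' t = nextVisit a t := by
  rcases eq_or_ne (nextVisit a t) ⊤ with htop | htop
  · rw [show a' = a from funext fun s => (h s (by simp [htop])).symm]
  obtain ⟨m, hm, htm, ham⟩ := exists_nextVisit_eq htop
  have ha'm : a' m = true := by rw [← h m hm.ge, ham]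
  have hle : nextVisit a' t ≤ nextVisit a t := hm ▸ nextVisit_le htm ha'm
  refine le_antisymm hle ?_
  obtain ⟨n, hn, htn, han⟩ := exists_nextVisit_eq (ne_top_of_le_ne_top htop hle)
  rw [hn]
  refine nextVisit_le htn ?_
  rw [h n (hn ▸ hle), han]

/-- The waiting time for the next visit is counted by the prefixes without a visit. -/
theorem nextVisit_le_tsum (a : ℕ → Bool) (t : ℕ) :
    ((nextVisit a t : ℕ∞) : ℝ≥0∞) ≤
      t + ∑' s : ℕ, {s | ∀ i ≤ s, a (t + i) = false}.indicator (fun _ => (1 : ℝ≥0∞)) s := by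
  by_cases hex : ∃ n, a (t + n) = true
  · classical
    have hspec := Nat.find_spec hex
    have h1 : nextVisit a t ≤ ((t + Nat.find hex : ℕ) : ℕ∞) :=
      nextVisit_le (by exact_mod_cast Nat.le_add_right _ _) hspec
    have h2 : ((nextVisit a t : ℕ∞) : ℝ≥0∞) ≤ (t : ℝ≥0∞) + (Nat.find hex : ℕ) := by
      have := ENat.toENNReal_le.2 h1
      simpa using this
    refine h2.trans (add_le_add le_rfl ?_)
    calc ((Nat.find hex : ℕ) : ℝ≥0∞) = ∑ _s ∈ Finset.range (Nat.find hex), (1 : ℝ≥0∞) := by simp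
      _ = ∑ s ∈ Finset.range (Nat.find hex),
            {s | ∀ i ≤ s, a (t + i) = false}.indicator (fun _ => (1 : ℝ≥0∞)) s := by
          refine Finset.sum_congr rfl fun s hs => ?_
          rw [Set.indicator_of_mem]
          intro i hi
          simpa using Nat.find_min hex (hi.trans_lt (Finset.mem_range.1 hs))
      _ ≤ _ := ENNReal.sum_le_tsum _
  · push Not at hex
    have : {s | ∀ i ≤ s, a (t + i) = false} = Set.univ :=
      Set.eq_univ_of_forall fun s i _ => by simpa using hex i
    simp [this]

theorem experimentEnd_mono (k : ℕ) (a : ℕ → Bool) : Monotone (experimentEnd k a) :=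
  monotone_nat_of_le_succ fun j => le_self_add.trans (le_nextVisit a (experimentEnd k a j + k))

theorem experimentEnd_congr {N : ℕ}
    (h : ∀ t : ℕ, (t : ℕ∞) ≤ experimentEnd k a N → a t = a' t) {j : ℕ} (hj : j ≤ N) :
    experimentEnd k a' j = experimentEnd k a j := by
  induction j with
  | zero => rfl
  | succ j ih =>
    rw [experimentEnd_succ, experimentEnd_succ, ih (by omega)]
    exact nextVisit_congr fun s hs => h s (hs.trans (experimentEnd_mono k a hj))

theorem successful_congr {N : ℕ}
    (h : ∀ t : ℕ, (t : ℕ∞) ≤ experimentEnd k a N → a t = a' t) {j : ℕ} (hj : j < N) :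
    Successful k a' j ↔ Successful k a j := by
  rw [Successful, Successful, experimentEnd_congr h hj.le, experimentEnd_congr h hj]

theorem estimate_congr {N : ℕ}
    (h : ∀ t : ℕ, (t : ℕ∞) ≤ experimentEnd k a N → a t = a' t) :
    estimate k N a' = estimate k N a := by
  classical
  rw [estimate, estimate, Finset.filter_congr fun j hj => successful_congr h (Finset.mem_range.1 hj)]

theorem successful_iff_of_experimentEnd_eq {j m : ℕ} (h : experimentEnd k a j = m) :
    Successful k a j ↔ a (m + k) = true := by
  have hcast : experimentEnd k a j + (k : ℕ∞) = ((m + k : ℕ) : ℕ∞) := by rw [h]; simp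
  rw [Successful, experimentEnd_succ, hcast, nextVisit_eq_self_iff, h]
  simp

/-- The regeneration property. Only `j = 0` needs the visit at time `0`. -/
theorem apply_experimentEnd (h0 : a 0 = true) {j m : ℕ} (h : experimentEnd k a j = m) :
    a m = true := by
  cases j with
  | zero =>
    have : m = 0 := by simpa [experimentEnd] using h.symm
    rwa [this]
  | succ j =>
    rw [experimentEnd_succ] at h
    obtain ⟨n, hn, -, han⟩ := exists_nextVisit_eq (a := a) (by rw [h]; simp)
    rw [h] at hn
    rwa [Nat.cast_inj.1 hn]

end Experiments

/-! ### Markov property and expected waiting times. -/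

section Walk

/-- Membership in `E` depends only on the trajectory up to time `m`. -/
def DeterminedBy {V Ω : Type*} (w : ℕ → Ω → V) (m : ℕ) (E : Set Ω) : Prop :=
  ∀ ω ω', (∀ i ≤ m, w i ω = w i ω') → ω ∈ E → ω' ∈ E

theorem DeterminedBy.inter {V Ω : Type*} {w : ℕ → Ω → V} {m : ℕ} {E F : Set Ω}
    (hE : DeterminedBy w m E) (hF : DeterminedBy w m F) : DeterminedBy w m (E ∩ F) :=
  fun ω ω' h hω => ⟨hE ω ω' h hω.1, hF ω ω' h hω.2⟩

theorem DeterminedBy.mono {V Ω : Type*} {w : ℕ → Ω → V} {m n : ℕ} {E : Set Ω}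
    (hE : DeterminedBy w m E) (hmn : m ≤ n) : DeterminedBy w n E :=
  fun ω ω' h => hE ω ω' fun i hi => h i (hi.trans hmn)

theorem determinedBy_univ {V Ω : Type*} (w : ℕ → Ω → V) (m : ℕ) :
    DeterminedBy w m Set.univ := fun _ _ _ _ => trivial

theorem determinedBy_eq {V Ω : Type*} (w : ℕ → Ω → V) {i m : ℕ} (hi : i ≤ m) (v : V) :
    DeterminedBy w m {ω | w i ω = v} :=
  fun _ _ h hω => (h i hi).symm.trans hω

theorem determinedBy_forall_ne {V Ω : Type*} (w : ℕ → Ω → V) (t s m : ℕ) (hm : t + s ≤ m + 1)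
    (v : V) : DeterminedBy w m {ω | ∀ i < s, w (t + i) ω ≠ v} :=
  fun _ _ h hω i hi => h (t + i) (by omega) ▸ hω i hi

variable {V Ω : Type*} [Fintype V] [MeasurableSpace Ω] {G : SimpleGraph V}
  [DecidableRel G.Adj] {r : V} {P : Measure Ω} {w : ℕ → Ω → V}

theorem IsSimpleRandomWalk.measurableSet_prefix (hw : IsSimpleRandomWalk G r P w) (m : ℕ)
    (x : Fin (m + 1) → V) :
    MeasurableSet ((fun ω (i : Fin (m + 1)) => w i ω) ⁻¹' {x}) := by
  have : (fun ω (i : Fin (m + 1)) => w i ω) ⁻¹' {x} = ⋂ i : Fin (m + 1), {ω | w i ω = x i} := by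
    ext ω
    simp [funext_iff]
  rw [this]
  exact MeasurableSet.iInter fun i => hw.measurableSet_eq i _

/-- As `V` is finite, such an event is a finite union of trajectory cylinders. -/
theorem IsSimpleRandomWalk.measurableSet (hw : IsSimpleRandomWalk G r P w) {m : ℕ} {E : Set Ω}
    (hE : DeterminedBy w m E) : MeasurableSet E := by
  have : E = ⋃ x ∈ (fun ω (i : Fin (m + 1)) => w i ω) '' E,
      (fun ω (i : Fin (m + 1)) => w i ω) ⁻¹' {x} := by
    ext ω
    simp only [Set.mem_iUnion, Set.mem_preimage, Set.mem_singleton_iff, exists_prop,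
      exists_eq_right', Set.mem_image]
    refine ⟨fun h => ⟨ω, h, rfl⟩, fun ⟨ω', h, heq⟩ => hE ω' ω (fun i hi => ?_) h⟩
    exact congrFun heq ⟨i, Nat.lt_succ_of_le hi⟩
  rw [this]
  exact MeasurableSet.biUnion (Set.to_countable _) fun x _ => hw.measurableSet_prefix m x

/-- Decomposition of an event according to the position at time `t`. -/
theorem IsSimpleRandomWalk.sum_measure_inter_eq (hw : IsSimpleRandomWalk G r P w) (t : ℕ)
    (E : Set Ω) : ∑ v, P (E ∩ {ω | w t ω = v}) = P E := by
  have h := sum_measure_preimage_singleton (μ := P.restrict E) Finset.univ (f := w t)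
    fun v _ => hw.measurableSet_eq t v
  rw [Finset.coe_univ, Set.preimage_univ, Measure.restrict_apply_univ] at h
  rw [← h]
  refine Finset.sum_congr rfl fun v _ => ?_
  rw [Set.inter_comm]
  exact (Measure.restrict_apply (hw.measurableSet_eq t v)).symm

/-- Decomposition of an event according to the trajectory up to time `m`. -/
theorem IsSimpleRandomWalk.sum_measure_inter_prefix (hw : IsSimpleRandomWalk G r P w) (m : ℕ)
    (E : Set Ω) :
    ∑ x, P (E ∩ (fun ω (i : Fin (m + 1)) => w i ω) ⁻¹' {x}) = P E := by
  classical
  have h := sum_measure_preimage_singleton (μ := P.restrict E) Finset.univ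
    (f := fun ω (i : Fin (m + 1)) => w i ω) fun x _ => hw.measurableSet_prefix m x
  rw [Finset.coe_univ, Set.preimage_univ, Measure.restrict_apply_univ] at h
  rw [← h]
  refine Finset.sum_congr rfl fun x _ => ?_
  rw [Measure.restrict_apply (hw.measurableSet_prefix m x), Set.inter_comm]

/-- The Markov property for one step. -/
theorem IsSimpleRandomWalk.measure_step (hw : IsSimpleRandomWalk G r P w) {m : ℕ} {E : Set Ω}
    (hE : DeterminedBy w m E) (u v : V) :
    P (E ∩ {ω | w m ω = u} ∩ {ω | w (m + 1) ω = v}) =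
      P (E ∩ {ω | w m ω = u}) * transitionProb G u v := by
  rw [← hw.sum_measure_inter_prefix m, ← hw.sum_measure_inter_prefix m (E ∩ {ω | w m ω = u}),
    Finset.sum_mul]
  refine Finset.sum_congr rfl fun x _ => ?_
  let y : ℕ → V := fun i => if h : i < m + 1 then x ⟨i, h⟩ else v
  have hy : ∀ i (h : i < m + 1), y i = x ⟨i, h⟩ := fun i h => dif_pos h
  have hyv : y (m + 1) = v := dif_neg (lt_irrefl _)
  have hpre : ∀ ω, (fun i : Fin (m + 1) => w i ω) = x ↔ ∀ i ≤ m, w i ω = y i := by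
    intro ω
    rw [funext_iff]
    refine ⟨fun h i hi => ?_, fun h i => ?_⟩
    · rw [hy i (by omega)]
      exact h ⟨i, by omega⟩
    · rw [h i (by omega), hy i i.2]
  -- A cylinder meeting the event lies inside it, and `step` applies to the trajectory extended by
  -- `v`; for any other cylinder both sides vanish.
  by_cases hne : (E ∩ {ω | w m ω = u} ∩
      (fun ω (i : Fin (m + 1)) => w i ω) ⁻¹' {x}).Nonempty
  · obtain ⟨ω₀, ⟨hω₀E, hω₀u⟩, hω₀x⟩ := hne
    have hω₀y := (hpre ω₀).1 hω₀x
    have hyu : y m = u := (hω₀y m le_rfl).symm.trans hω₀u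
    have hmem : ∀ ω, (∀ i ≤ m, w i ω = y i) → ω ∈ E :=
      fun ω h => hE ω₀ ω (fun i hi => (hω₀y i hi).trans (h i hi).symm) hω₀E
    have h1 : E ∩ {ω | w m ω = u} ∩ {ω | w (m + 1) ω = v} ∩
        (fun ω (i : Fin (m + 1)) => w i ω) ⁻¹' {x} = {ω | ∀ i ≤ m + 1, w i ω = y i} := by
      ext ω
      simp only [Set.mem_inter_iff, Set.mem_ofPred_eq, Set.mem_preimage, Set.mem_singleton_iff, hpre]
      refine ⟨fun ⟨⟨_, hv⟩, h⟩ i hi => ?_, fun h => ?_⟩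
      · rcases Nat.lt_or_ge m i with hlt | hle
        · rw [show i = m + 1 by omega, hv, hyv]
        · exact h i hle
      · have h' : ∀ i ≤ m, w i ω = y i := fun i hi => h i (by omega)
        exact ⟨⟨⟨hmem ω h', (h' m le_rfl).trans hyu⟩, (h (m + 1) le_rfl).trans hyv⟩, h'⟩
    have h2 : E ∩ {ω | w m ω = u} ∩ (fun ω (i : Fin (m + 1)) => w i ω) ⁻¹' {x} =
        {ω | ∀ i ≤ m, w i ω = y i} := by
      ext ω
      simp only [Set.mem_inter_iff, Set.mem_ofPred_eq, Set.mem_preimage, Set.mem_singleton_iff, hpre]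
      exact ⟨fun h => h.2, fun h => ⟨⟨hmem ω h, (h m le_rfl).trans hyu⟩, h⟩⟩
    rw [h1, h2, hw.step m y, hyu, hyv]
  · have h2 := Set.not_nonempty_iff_eq_empty.1 hne
    have h1 : E ∩ {ω | w m ω = u} ∩ {ω | w (m + 1) ω = v} ∩
        (fun ω (i : Fin (m + 1)) => w i ω) ⁻¹' {x} = ∅ :=
      Set.eq_empty_of_forall_notMem fun ω h => hne ⟨ω, h.1.1, h.2⟩
    rw [h1, h2]
    simp

/-- The `s`-step transition probabilities. -/
noncomputable def stepProb (G : SimpleGraph V) [DecidableRel G.Adj] (u : V) : ℕ → V → ℝ≥0∞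
  | 0, v => by classical exact if u = v then 1 else 0
  | s + 1, v => ∑ y, stepProb G u s y * transitionProb G y v

/-- The Markov property for several steps. -/
theorem IsSimpleRandomWalk.measure_steps (hw : IsSimpleRandomWalk G r P w) {m : ℕ} {E : Set Ω}
    (hE : DeterminedBy w m E) (u : V) (s : ℕ) (v : V) :
    P (E ∩ {ω | w m ω = u} ∩ {ω | w (m + s) ω = v}) =
      P (E ∩ {ω | w m ω = u}) * stepProb G u s v := by
  classical
  induction s generalizing v with
  | zero =>
    by_cases huv : u = v
    · subst huv
      rw [add_zero, Set.inter_assoc, Set.inter_self]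
      simp [stepProb]
    · have : E ∩ {ω | w m ω = u} ∩ {ω | w (m + 0) ω = v} = ∅ := by
        ext ω
        simp only [add_zero, Set.mem_inter_iff, Set.mem_ofPred_eq, Set.mem_empty_iff_false,
          iff_false, not_and]
        exact fun h h' => huv (h.2.symm.trans h')
      rw [this]
      simp [stepProb, huv]
  | succ s ih =>
    rw [← hw.sum_measure_inter_eq (m + s), stepProb, Finset.mul_sum]
    refine Finset.sum_congr rfl fun y _ => ?_
    have hE' : DeterminedBy w (m + s) (E ∩ {ω | w m ω = u}) :=
      (hE.mono (by omega)).inter (determinedBy_eq w (by omega) u)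
    rw [Set.inter_right_comm, ← add_assoc, hw.measure_step hE', ih, mul_assoc]

theorem IsSimpleRandomWalk.measure_start [IsProbabilityMeasure P]
    (hw : IsSimpleRandomWalk G r P w) : P {ω | w 0 ω = r} = 1 :=
  (mem_ae_iff_prob_eq_one (hw.measurableSet_eq 0 r)).1 hw.start

theorem IsSimpleRandomWalk.measure_eq_stepProb [IsProbabilityMeasure P]
    (hw : IsSimpleRandomWalk G r P w) (s : ℕ) (v : V) :
    P {ω | w s ω = v} = stepProb G r s v := by
  have h := hw.measure_steps (determinedBy_univ w 0) r s v
  rw [Set.univ_inter, hw.measure_start, one_mul, zero_add] at h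
  rw [← h]
  exact (Measure.measure_inter_eq_of_ae (s := {ω | w s ω = v})
    (t := {ω | w 0 ω = r}) hw.start).symm

theorem exists_transitionProb_potential [DecidableEq V] (hG : G.Connected)
    (hV : 1 < Fintype.card V) (r : V) :
    ∃ f : V → ℝ≥0∞, (∀ x, f x ≤ ENNReal.ofReal (2 * (Fintype.card V : ℝ) ^ 3)) ∧
      ∀ x, x ≠ r → 1 + ∑ y, transitionProb G x y * f y = f x := by
  obtain ⟨f, hf0, hfle, hf⟩ := exists_potential hG hV r
  refine ⟨fun x => ENNReal.ofReal (f x), fun x => ENNReal.ofReal_le_ofReal (hfle x),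
    fun x hx => ?_⟩
  have : Nontrivial V := Fintype.one_lt_card_iff_nontrivial.1 hV
  have hd : (0 : ℝ) < G.degree x := by
    exact_mod_cast hG.preconnected.degree_pos_of_nontrivial x
  have hterm : ∀ y, transitionProb G x y * ENNReal.ofReal (f y) =
      ENNReal.ofReal (if G.Adj x y then (G.degree x : ℝ)⁻¹ * f y else 0) := by
    intro y
    rw [transitionProb]
    split_ifs
    · rw [ENNReal.ofReal_mul (by positivity), ENNReal.ofReal_inv_of_pos hd, ENNReal.ofReal_natCast]
    · simp
  have hnn : ∀ y, 0 ≤ if G.Adj x y then (G.degree x : ℝ)⁻¹ * f y else 0 := by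
    intro y
    have := hf0 y
    split_ifs <;> positivity
  simp only [hterm]
  rw [← ENNReal.ofReal_sum_of_nonneg fun y _ => hnn y, ← ENNReal.ofReal_one,
    ← ENNReal.ofReal_add zero_le_one (Finset.sum_nonneg fun y _ => hnn y)]
  congr 1
  rw [← Finset.sum_filter, ← Finset.mul_sum, ← SimpleGraph.neighborFinset_eq_filter]
  have h := hf x hx
  field_simp
  linarith

/-- The expected waiting time for the next visit after a fixed time. -/
theorem IsSimpleRandomWalk.tsum_measure_forall_ne_le (hw : IsSimpleRandomWalk G r P w)
    {f : V → ℝ≥0∞} {H : ℝ≥0∞} (hfH : ∀ x, f x ≤ H)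
    (hf : ∀ x, x ≠ r → 1 + ∑ y, transitionProb G x y * f y = f x)
    {t : ℕ} {E : Set Ω} (hE : DeterminedBy w t E) :
    ∑' s, P (E ∩ {ω | ∀ i < s + 1, w (t + i) ω ≠ r}) ≤ H * P E := by
  let E' : ℕ → Set Ω := fun s => E ∩ {ω | ∀ i < s, w (t + i) ω ≠ r}
  -- The mean potential at time `t + s` on the part of `E` where `r` is avoided at times `t, …, t +
  -- s - 1`. Each step lowers it by at least the probability of also avoiding `r` at time `t + s`;
  -- these losses telescope.
  let b : ℕ → ℝ≥0∞ := fun s => ∑ v, P (E' s ∩ {ω | w (t + s) ω = v}) * f v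
  have hdet : ∀ s, DeterminedBy w (t + s) (E' (s + 1)) := fun s =>
    (hE.mono (by omega)).inter (determinedBy_forall_ne w t (s + 1) (t + s) (by omega) r)
  have hEr : ∀ s, E' (s + 1) ∩ {ω | w (t + s) ω = r} = ∅ := by
    intro s
    ext ω
    simp only [E', Set.mem_inter_iff, Set.mem_ofPred_eq, Set.mem_empty_iff_false, iff_false]
    exact fun h => h.1.2 s (by omega) h.2
  have hsub : ∀ s, E' (s + 1) ⊆ E' s := fun s ω h => ⟨h.1, fun i hi => h.2 i (by omega)⟩
  have hb : ∀ s, P (E' (s + 1)) + b (s + 1) ≤ b s := by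
    intro s
    have h1 : b (s + 1) = ∑ u, P (E' (s + 1) ∩ {ω | w (t + s) ω = u}) *
        ∑ v, transitionProb G u v * f v := by
      simp only [b, Finset.mul_sum]
      rw [Finset.sum_comm]
      refine Finset.sum_congr rfl fun v _ => ?_
      rw [← hw.sum_measure_inter_eq (t + s), Finset.sum_mul]
      refine Finset.sum_congr rfl fun u _ => ?_
      rw [Set.inter_right_comm, ← add_assoc, hw.measure_step (hdet s), mul_assoc]
    rw [h1, ← hw.sum_measure_inter_eq (t + s) (E' (s + 1)), ← Finset.sum_add_distrib]
    refine Finset.sum_le_sum fun u _ => ?_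
    by_cases hu : u = r
    · rw [hu, hEr]
      simp
    · rw [← mul_one_add, hf u hu]
      gcongr
      exact hsub s
  have hpartial : ∀ n, ∑ s ∈ Finset.range n, P (E' (s + 1)) + b n ≤ b 0 := by
    intro n
    induction n with
    | zero => simp
    | succ n ih =>
      rw [Finset.sum_range_succ, add_assoc]
      exact (add_le_add le_rfl (hb n)).trans ih
  have hb0 : b 0 ≤ H * P E := by
    calc b 0 ≤ ∑ v, P (E ∩ {ω | w t ω = v}) * H := by
          refine Finset.sum_le_sum fun v _ => mul_le_mul' (measure_mono ?_) (hfH v)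
          exact fun ω h => ⟨h.1.1, h.2⟩
      _ = _ := by rw [← Finset.sum_mul, hw.sum_measure_inter_eq, mul_comm]
  exact ENNReal.tsum_le_of_sum_range_le fun n => (le_self_add.trans (hpartial n)).trans hb0

end Walk

/-! ### Regeneration at the ends of experiments. -/

section Estimation

variable {V Ω : Type*} [DecidableEq V] {r : V} {w : ℕ → Ω → V} {k : ℕ}

theorem observed_eq_true_iff {ω : Ω} {t : ℕ} : observed r w ω t = true ↔ w t ω = r := by
  simp [observed]

theorem observed_eq_of_le {ω ω' : Ω} {m : ℕ} (h : ∀ i ≤ m, w i ω = w i ω') {t : ℕ}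
    (ht : t ≤ m) : observed r w ω t = observed r w ω' t := by
  simp [observed, h t ht]

theorem determinedBy_experimentEnd (r : V) (w : ℕ → Ω → V) (k j m : ℕ) :
    DeterminedBy w m {ω | experimentEnd k (observed r w ω) j = m} := by
  intro ω ω' h hω
  rw [Set.mem_ofPred_eq] at hω ⊢
  rw [experimentEnd_congr (fun t ht => observed_eq_of_le h ?_) le_rfl, hω]
  rw [hω] at ht
  exact_mod_cast ht

theorem determinedBy_successful (r : V) (w : ℕ → Ω → V) (k m : ℕ) {j : ℕ} (s : Finset ℕ)
    (hs : ∀ i ∈ s, i < j) :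
    DeterminedBy w m ({ω | experimentEnd k (observed r w ω) j = m} ∩
      ⋂ i ∈ s, {ω | Successful k (observed r w ω) i}) := by
  rintro ω ω' h ⟨hω, hsucc⟩
  refine ⟨determinedBy_experimentEnd r w k j m ω ω' h hω, ?_⟩
  rw [Set.mem_ofPred_eq] at hω
  simp only [Set.mem_iInter, Set.mem_ofPred_eq] at hsucc ⊢
  intro i hi
  refine (successful_congr (N := j) (fun t ht => observed_eq_of_le h ?_) (hs i hi)).2 (hsucc i hi)
  rw [hω] at ht
  exact_mod_cast ht

theorem pairwise_disjoint_experimentEnd_eq (r : V) (w : ℕ → Ω → V) (k j : ℕ) :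
    Pairwise (Function.onFun Disjoint
      fun m : ℕ => {ω | experimentEnd k (observed r w ω) j = m}) := by
  intro m n hmn
  refine Set.disjoint_left.2 fun ω h1 h2 => hmn ?_
  rw [Set.mem_ofPred_eq] at h1 h2
  exact Nat.cast_inj.1 (h1.symm.trans h2)

theorem ae_mem_iUnion_experimentEnd {_ : MeasurableSpace Ω} {P : Measure Ω} {j : ℕ}
    (hfin : ∀ᵐ ω ∂P, experimentEnd k (observed r w ω) j ≠ ⊤) :
    ∀ᵐ ω ∂P, ω ∈ ⋃ m : ℕ, {ω | experimentEnd k (observed r w ω) j = m} := by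
  filter_upwards [hfin] with ω hω
  obtain ⟨m, hm⟩ := ENat.ne_top_iff_exists.1 hω
  exact Set.mem_iUnion.2 ⟨m, hm.symm⟩

variable [Fintype V] [MeasurableSpace Ω] {G : SimpleGraph V}
  [DecidableRel G.Adj] {P : Measure Ω}

theorem IsSimpleRandomWalk.measurableSet_experimentEnd_eq (hw : IsSimpleRandomWalk G r P w)
    (k j m : ℕ) : MeasurableSet {ω | experimentEnd k (observed r w ω) j = m} :=
  hw.measurableSet (determinedBy_experimentEnd r w k j m)

theorem IsSimpleRandomWalk.measurable_experimentEnd (hw : IsSimpleRandomWalk G r P w)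
    (k j : ℕ) : Measurable fun ω => experimentEnd k (observed r w ω) j := by
  refine measurable_to_countable' fun x => ?_
  induction x using ENat.recTopCoe with
  | top =>
    have : (fun ω => experimentEnd k (observed r w ω) j) ⁻¹' {⊤} =
        (⋃ m : ℕ, {ω | experimentEnd k (observed r w ω) j = m})ᶜ := by
      ext ω
      rw [Set.mem_compl_iff, Set.mem_iUnion, Set.mem_preimage, Set.mem_singleton_iff,
        ← not_iff_not, not_not]
      exact ENat.ne_top_iff_exists.trans (exists_congr fun m => eq_comm)
    rw [this]
    exact (MeasurableSet.iUnion fun m => hw.measurableSet_experimentEnd_eq k j m).compl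
  | coe m => exact hw.measurableSet_experimentEnd_eq k j m

theorem IsSimpleRandomWalk.measurableSet_successful (hw : IsSimpleRandomWalk G r P w)
    (k j : ℕ) : MeasurableSet {ω | Successful k (observed r w ω) j} := by
  have h1 := hw.measurable_experimentEnd k j
  have h2 := hw.measurable_experimentEnd k (j + 1)
  exact (h1 (MeasurableSet.singleton ⊤).compl).inter
    (measurableSet_eq_fun h2 (h1.add_const (k : ℕ∞)))

/-- Integration according to the end of the first `j` experiments. -/
theorem IsSimpleRandomWalk.lintegral_eq_tsum (hw : IsSimpleRandomWalk G r P w) {j : ℕ}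
    (hfin : ∀ᵐ ω ∂P, experimentEnd k (observed r w ω) j ≠ ⊤) (g : Ω → ℝ≥0∞) :
    ∫⁻ ω, g ω ∂P =
      ∑' m : ℕ, ∫⁻ ω in {ω | experimentEnd k (observed r w ω) j = m}, g ω ∂P := by
  rw [← lintegral_iUnion (fun m => hw.measurableSet_experimentEnd_eq k j m)
    (pairwise_disjoint_experimentEnd_eq r w k j),
    Measure.restrict_eq_self_of_ae_mem (ae_mem_iUnion_experimentEnd hfin)]

theorem IsSimpleRandomWalk.measure_eq_tsum (hw : IsSimpleRandomWalk G r P w) {j : ℕ}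
    (hfin : ∀ᵐ ω ∂P, experimentEnd k (observed r w ω) j ≠ ⊤) {B : Set Ω} (hB : MeasurableSet B) :
    P B = ∑' m : ℕ, P ({ω | experimentEnd k (observed r w ω) j = m} ∩ B) := by
  rw [← lintegral_indicator_one hB, hw.lintegral_eq_tsum hfin]
  refine tsum_congr fun m => ?_
  rw [lintegral_indicator_one hB, Measure.restrict_apply hB, Set.inter_comm]

theorem IsSimpleRandomWalk.lintegral_nextVisit_le (hw : IsSimpleRandomWalk G r P w)
    {f : V → ℝ≥0∞} {H : ℝ≥0∞} (hfH : ∀ x, f x ≤ H)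
    (hf : ∀ x, x ≠ r → 1 + ∑ y, transitionProb G x y * f y = f x)
    {t : ℕ} {E : Set Ω} (hE : DeterminedBy w t E) :
    ∫⁻ ω in E, ((nextVisit (observed r w ω) t : ℕ∞) : ℝ≥0∞) ∂P ≤ (t + H) * P E := by
  have hdet : ∀ s, MeasurableSet {ω | ∀ i < s + 1, w (t + i) ω ≠ r} := fun s =>
    hw.measurableSet (determinedBy_forall_ne w t (s + 1) (t + s) (by omega) r)
  calc ∫⁻ ω in E, ((nextVisit (observed r w ω) t : ℕ∞) : ℝ≥0∞) ∂P
      ≤ ∫⁻ ω in E, (t + ∑' s : ℕ,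
          {ω | ∀ i < s + 1, w (t + i) ω ≠ r}.indicator (fun _ => (1 : ℝ≥0∞)) ω) ∂P := by
        refine lintegral_mono fun ω => (nextVisit_le_tsum _ t).trans_eq ?_
        congr 1
        refine tsum_congr fun s => ?_
        simp [Set.indicator, observed]
    _ = t * P E + ∑' s, P (E ∩ {ω | ∀ i < s + 1, w (t + i) ω ≠ r}) := by
        rw [lintegral_add_left measurable_const, lintegral_const, Measure.restrict_apply_univ,
          lintegral_tsum fun s => (measurable_const.indicator (hdet s)).aemeasurable]
        congr 1
        refine tsum_congr fun s => ?_
        rw [lintegral_indicator_const (hdet s), one_mul, Measure.restrict_apply (hdet s),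
          Set.inter_comm]
    _ ≤ t * P E + H * P E := by
        gcongr
        exact hw.tsum_measure_forall_ne_le hfH hf hE
    _ = _ := (add_mul _ _ _).symm

/-- On `S_j = m` the wait begins at time `m + k`, wherever the walk then is; `H` bounds the
potential at every vertex. -/
theorem IsSimpleRandomWalk.lintegral_experimentEnd_succ_le [IsProbabilityMeasure P]
    (hw : IsSimpleRandomWalk G r P w)
    {f : V → ℝ≥0∞} {H : ℝ≥0∞} (hfH : ∀ x, f x ≤ H)
    (hf : ∀ x, x ≠ r → 1 + ∑ y, transitionProb G x y * f y = f x) {j : ℕ}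
    (hfin : ∀ᵐ ω ∂P, experimentEnd k (observed r w ω) j ≠ ⊤) :
    ∫⁻ ω, ((experimentEnd k (observed r w ω) (j + 1) : ℕ∞) : ℝ≥0∞) ∂P ≤
      ∫⁻ ω, ((experimentEnd k (observed r w ω) j : ℕ∞) : ℝ≥0∞) ∂P + (k + H) := by
  have hrhs : ∫⁻ ω, ((experimentEnd k (observed r w ω) j : ℕ∞) : ℝ≥0∞) ∂P + (k + H) =
      ∫⁻ ω, (((experimentEnd k (observed r w ω) j : ℕ∞) : ℝ≥0∞) + (k + H)) ∂P := by
    rw [lintegral_add_right _ measurable_const, lintegral_const, measure_univ, mul_one]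
  rw [hrhs, hw.lintegral_eq_tsum hfin, hw.lintegral_eq_tsum hfin]
  refine ENNReal.tsum_le_tsum fun m => ?_
  have hS := hw.measurableSet_experimentEnd_eq k j m
  have hdet : DeterminedBy w (m + k) {ω | experimentEnd k (observed r w ω) j = m} :=
    (determinedBy_experimentEnd r w k j m).mono (by omega)
  calc _ = ∫⁻ ω in {ω | experimentEnd k (observed r w ω) j = m},
        ((nextVisit (observed r w ω) ((m + k : ℕ) : ℕ∞) : ℕ∞) : ℝ≥0∞) ∂P := by
        refine setLIntegral_congr_fun hS fun ω hω => ?_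
        rw [Set.mem_ofPred_eq] at hω
        simp only [experimentEnd_succ, hω, Nat.cast_add]
    _ ≤ (((m + k : ℕ) : ℝ≥0∞) + H) * P {ω | experimentEnd k (observed r w ω) j = m} :=
        hw.lintegral_nextVisit_le hfH hf hdet
    _ = ∫⁻ _ω in {ω | experimentEnd k (observed r w ω) j = m}, ((m : ℝ≥0∞) + (k + H)) ∂P := by
        rw [setLIntegral_const]
        push_cast
        rw [add_assoc]
    _ = _ := by
        refine setLIntegral_congr_fun hS fun ω hω => ?_
        rw [Set.mem_ofPred_eq] at hω
        simp [hω]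

theorem IsSimpleRandomWalk.ae_experimentEnd_ne_top_of_lintegral
    (hw : IsSimpleRandomWalk G r P w) {j : ℕ}
    (h : ∫⁻ ω, ((experimentEnd k (observed r w ω) j : ℕ∞) : ℝ≥0∞) ∂P ≠ ⊤) :
    ∀ᵐ ω ∂P, experimentEnd k (observed r w ω) j ≠ ⊤ := by
  have hmeas : Measurable fun ω => ((experimentEnd k (observed r w ω) j : ℕ∞) : ℝ≥0∞) :=
    Measurable.of_discrete.comp (hw.measurable_experimentEnd k j)
  filter_upwards [ae_lt_top hmeas h] with ω hω htop
  simp [htop] at hω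

theorem IsSimpleRandomWalk.lintegral_experimentEnd_le [IsProbabilityMeasure P]
    (hw : IsSimpleRandomWalk G r P w) (hG : G.Connected) (hV : 1 < Fintype.card V) (k j : ℕ) :
    ∫⁻ ω, ((experimentEnd k (observed r w ω) j : ℕ∞) : ℝ≥0∞) ∂P ≤
      j * (k + ENNReal.ofReal (2 * (Fintype.card V : ℝ) ^ 3)) := by
  obtain ⟨f, hfH, hf⟩ := exists_transitionProb_potential hG hV r
  induction j with
  | zero => simp [experimentEnd]
  | succ j ih =>
    -- The bound for `j` makes `S_j` almost surely finite, which the decomposition over its values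
    -- requires.
    have hfin := hw.ae_experimentEnd_ne_top_of_lintegral (ne_top_of_le_ne_top (by finiteness) ih)
    refine (hw.lintegral_experimentEnd_succ_le hfH hf hfin).trans ?_
    push_cast
    rw [add_one_mul]
    gcongr

theorem IsSimpleRandomWalk.ae_experimentEnd_ne_top [IsProbabilityMeasure P]
    (hw : IsSimpleRandomWalk G r P w) (hG : G.Connected) (hV : 1 < Fintype.card V) (k j : ℕ) :
    ∀ᵐ ω ∂P, experimentEnd k (observed r w ω) j ≠ ⊤ :=
  hw.ae_experimentEnd_ne_top_of_lintegral
    (ne_top_of_le_ne_top (by finiteness) (hw.lintegral_experimentEnd_le hG hV k j))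

/-- An experiment succeeds with probability `P_k(r, r)`, independently of the earlier ones. -/
theorem IsSimpleRandomWalk.measure_biInter_insert [IsProbabilityMeasure P]
    (hw : IsSimpleRandomWalk G r P w) (hG : G.Connected) (hV : 1 < Fintype.card V) (k : ℕ)
    {j : ℕ} {s : Finset ℕ} (hs : ∀ i ∈ s, i < j) :
    P (⋂ i ∈ insert j s, {ω | Successful k (observed r w ω) i}) =
      P {ω | w k ω = r} * P (⋂ i ∈ s, {ω | Successful k (observed r w ω) i}) := by
  have hfin := hw.ae_experimentEnd_ne_top hG hV k j
  have hmeas : ∀ s : Finset ℕ,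
      MeasurableSet (⋂ i ∈ s, {ω | Successful k (observed r w ω) i}) := fun s =>
    Finset.measurableSet_biInter s fun i _ => hw.measurableSet_successful k i
  rw [hw.measure_eq_tsum hfin (hmeas _), hw.measure_eq_tsum hfin (hmeas s), ← ENNReal.tsum_mul_left]
  refine tsum_congr fun m => ?_
  set E := {ω | experimentEnd k (observed r w ω) j = m} ∩
    ⋂ i ∈ s, {ω | Successful k (observed r w ω) i} with hE
  have hEr : P E = P (E ∩ {ω | w m ω = r}) := by
    refine measure_congr ?_
    filter_upwards [hw.start] with ω h0
    refine propext ⟨fun h => ⟨h, ?_⟩, fun h => h.1⟩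
    exact observed_eq_true_iff.1 (apply_experimentEnd (observed_eq_true_iff.2 h0) h.1)
  have hsucc : P ({ω | experimentEnd k (observed r w ω) j = m} ∩
      ⋂ i ∈ insert j s, {ω | Successful k (observed r w ω) i}) =
      P (E ∩ {ω | w m ω = r} ∩ {ω | w (m + k) ω = r}) := by
    refine measure_congr ?_
    filter_upwards [hw.start] with ω h0
    rw [Finset.set_biInter_insert]
    refine propext ⟨fun h => ?_, fun h => ?_⟩
    · obtain ⟨hj, hsj, hss⟩ := h
      exact ⟨⟨⟨hj, hss⟩,
        observed_eq_true_iff.1 (apply_experimentEnd (observed_eq_true_iff.2 h0) hj)⟩,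
        observed_eq_true_iff.1 ((successful_iff_of_experimentEnd_eq hj).1 hsj)⟩
    · obtain ⟨⟨⟨hj, hss⟩, -⟩, hk⟩ := h
      exact ⟨hj, (successful_iff_of_experimentEnd_eq hj).2 (observed_eq_true_iff.2 hk), hss⟩
  rw [hsucc, hw.measure_steps (determinedBy_successful r w k m s hs), ← hEr,
    hw.measure_eq_stepProb, mul_comm]

theorem IsSimpleRandomWalk.measure_biInter_successful [IsProbabilityMeasure P]
    (hw : IsSimpleRandomWalk G r P w) (hG : G.Connected) (hV : 1 < Fintype.card V) (k : ℕ)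
    (s : Finset ℕ) :
    P (⋂ i ∈ s, {ω | Successful k (observed r w ω) i}) = P {ω | w k ω = r} ^ s.card := by
  -- The latest experiment is split off, since the Markov step conditions on earlier ones only.
  induction s using Finset.induction_on_max with
  | empty => simp
  | insert j s hs ih =>
    rw [hw.measure_biInter_insert hG hV k hs, ih,
      Finset.card_insert_of_notMem fun h => lt_irrefl j (hs j h), pow_succ']

theorem IsSimpleRandomWalk.measure_successful [IsProbabilityMeasure P]
    (hw : IsSimpleRandomWalk G r P w) (hG : G.Connected) (hV : 1 < Fintype.card V) (k j : ℕ) :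
    P {ω | Successful k (observed r w ω) j} = P {ω | w k ω = r} := by
  simpa using hw.measure_biInter_successful hG hV k {j}

theorem IsSimpleRandomWalk.iIndepSet_successful [IsProbabilityMeasure P]
    (hw : IsSimpleRandomWalk G r P w) (hG : G.Connected) (hV : 1 < Fintype.card V) (k : ℕ) :
    iIndepSet (fun j : ℕ => {ω | Successful k (observed r w ω) j}) P := by
  rw [iIndepSet_iff_meas_biInter fun j => hw.measurableSet_successful k j]
  intro s
  simp [hw.measure_biInter_successful hG hV, hw.measure_successful hG hV]

end Estimation

/-! ### Concentration of the relative frequency. -/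

section Chebyshev

variable {Ω : Type*} [MeasurableSpace Ω] {P : Measure Ω} [IsProbabilityMeasure P]

/-- Chebyshev's inequality for the relative frequency of independent events. -/
theorem measureReal_frequency_sub_ge_le {A : ℕ → Set Ω} (hA : ∀ j, MeasurableSet (A j))
    (hind : iIndepSet A P) {p : ℝ} (hp : ∀ j, P.real (A j) = p) {N : ℕ} (hN : N ≠ 0) {ε : ℝ}
    (hε : 0 < ε) :
    P.real {ω | ε ≤ |(∑ j ∈ Finset.range N, (A j).indicator (fun _ => (1 : ℝ)) ω) / N - p|} ≤
      (4 * N * ε ^ 2)⁻¹ := by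
  let X : ℕ → Ω → ℝ := fun j => (A j).indicator fun _ => 1
  have hX : ∀ j, MemLp (X j) 2 P := fun j =>
    memLp_indicator_const 2 (hA j) 1 (Or.inr (measure_ne_top P _))
  have hN' : (0 : ℝ) < N := by exact_mod_cast Nat.pos_of_ne_zero hN
  have hmean : P[∑ j ∈ Finset.range N, X j] = N * p := by
    simp only [Finset.sum_apply]
    rw [integral_finsetSum _ fun j _ => (hX j).integrable one_le_two]
    simp [X, integral_indicator_const, hA, hp]
  have hvar : Var[∑ j ∈ Finset.range N, X j; P] ≤ N / 4 := by
    rw [IndepFun.variance_sum (fun j _ => hX j) fun i _ j _ hij =>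
      (hind.iIndepFun_indicator (β := ℝ)).indepFun hij]
    -- Popoviciu's inequality for variables with values in `[0, 1]`.
    calc ∑ j ∈ Finset.range N, Var[X j; P] ≤ ∑ _j ∈ Finset.range N, ((1 - 0) / 2 : ℝ) ^ 2 := by
          refine Finset.sum_le_sum fun j _ => variance_le_sq_of_bounded ?_ (hX j).aemeasurable
          refine ae_of_all _ fun ω => ?_
          by_cases h : ω ∈ A j <;> simp [X, h]
      _ = N / 4 := by
          rw [Finset.sum_const, Finset.card_range, nsmul_eq_mul]
          ring
  have hcheb := meas_ge_le_variance_div_sq (memLp_finsetSum' (Finset.range N) fun j _ => hX j)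
    (mul_pos hN' hε)
  rw [hmean] at hcheb
  have hset : {ω | ε ≤ |(∑ j ∈ Finset.range N, (A j).indicator (fun _ => (1 : ℝ)) ω) / N - p|} =
      {ω | N * ε ≤ |(∑ j ∈ Finset.range N, X j) ω - N * p|} := by
    ext ω
    simp only [Set.mem_ofPred_eq, Finset.sum_apply]
    rw [← mul_le_mul_iff_right₀ hN', ← abs_of_pos hN', ← abs_mul, abs_of_pos hN', mul_sub,
      mul_div_cancel₀ _ hN'.ne']
  rw [hset, measureReal_def]
  refine (ENNReal.toReal_le_of_le_ofReal 
    (div_nonneg (variance_nonneg _ _) (sq_nonneg _)) hcheb).trans ?_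
  calc _ ≤ (N / 4 : ℝ) / (N * ε) ^ 2 := by gcongr
    _ = _ := by field_simp

end Chebyshev

/-! ### The choice of `N` and the final bounds. -/

section Accuracy

theorem estimate_eq_sum_indicator {Ω : Type*} (k N : ℕ) (a : Ω → ℕ → Bool) (ω : Ω) :
    estimate k N (a ω) =
      (∑ j ∈ Finset.range N, {ω | Successful k (a ω) j}.indicator (fun _ => (1 : ℝ)) ω) / N := by
  classical
  rw [estimate, Finset.card_filter]
  push_cast
  simp [Set.indicator]

theorem experimentCount_le (ε δ : ℝ) (hδ : 0 < δ) :
    (experimentCount ε δ : ℝ) ≤ (ε ^ 2)⁻¹ * δ⁻¹ := by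
  rw [← mul_inv]
  exact Nat.floor_le (by positivity)

/-- For `N ≥ 1`, `4 N ≥ N + 1 > (ε² δ)⁻¹`. -/
theorem inv_le_of_experimentCount_ne_zero {ε δ : ℝ} (hε : 0 < ε) (hδ : 0 < δ)
    (h : experimentCount ε δ ≠ 0) : (4 * (experimentCount ε δ : ℝ) * ε ^ 2)⁻¹ ≤ δ := by
  have h1 : (1 : ℝ) ≤ experimentCount ε δ := by exact_mod_cast Nat.one_le_iff_ne_zero.2 h
  have h2 : (ε ^ 2 * δ)⁻¹ < experimentCount ε δ + 1 := Nat.lt_floor_add_one _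
  have h3 : 1 < (experimentCount ε δ + 1) * (ε ^ 2 * δ) := by
    rwa [inv_lt_iff_one_lt_mul₀ (by positivity)] at h2
  rw [inv_le_iff_one_le_mul₀ (by positivity)]
  have h4 : (experimentCount ε δ + 1) * (ε ^ 2 * δ) ≤
      (4 * (experimentCount ε δ : ℝ)) * (ε ^ 2 * δ) := by
    gcongr
    linarith
  linarith

theorem one_lt_or_one_lt_of_experimentCount_eq_zero {ε δ : ℝ} (hε : 0 < ε) (hδ : 0 < δ)
    (h : experimentCount ε δ = 0) : 1 < ε ∨ 1 < δ := by
  by_contra! hle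
  have h1 : (ε ^ 2 * δ)⁻¹ < 1 := Nat.floor_eq_zero.1 h
  rw [inv_lt_one_iff₀] at h1
  have h2 : ε ^ 2 * δ ≤ 1 := mul_le_one₀ (pow_le_one₀ hε.le hle.1) hδ.le hle.2
  rcases h1 with h1 | h1
  · exact absurd h1 (not_le.2 (by positivity))
  · linarith

variable {V Ω : Type*} [DecidableEq V] [Fintype V] [MeasurableSpace Ω] {G : SimpleGraph V}
  [DecidableRel G.Adj] {P : Measure Ω} [IsProbabilityMeasure P] {r : V} {w : ℕ → Ω → V}

theorem IsSimpleRandomWalk.one_sub_le_measureReal_estimate (hw : IsSimpleRandomWalk G r P w)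
    (hG : G.Connected) (hV : 1 < Fintype.card V) (k : ℕ) {ε δ : ℝ} (hε : 0 < ε) (hδ : 0 < δ) :
    1 - δ ≤ P.real {ω |
      |estimate k (experimentCount ε δ) (observed r w ω) - P.real {ω' | w k ω' = r}| < ε} := by
  by_cases hN : experimentCount ε δ = 0
  · rcases one_lt_or_one_lt_of_experimentCount_eq_zero hε hδ hN with h | h
    · have : {ω | |estimate k (experimentCount ε δ) (observed r w ω) -
          P.real {ω' | w k ω' = r}| < ε} = Set.univ := by
        refine Set.eq_univ_of_forall fun ω => ?_
        simp only [hN, estimate, Set.mem_ofPred_eq, Nat.cast_zero, div_zero, zero_sub, abs_neg]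
        rw [abs_of_nonneg measureReal_nonneg]
        exact measureReal_le_one.trans_lt h
      rw [this, probReal_univ]
      linarith
    · exact (sub_neg.2 h).le.trans measureReal_nonneg
  · have hA := fun j => hw.measurableSet_successful k j
    have hcheb := measureReal_frequency_sub_ge_le hA (hw.iIndepSet_successful hG hV k)
      (fun j => congrArg ENNReal.toReal (hw.measure_successful hG hV k j)) hN hε
    have hmeas : MeasurableSet {ω | ε ≤ |(∑ j ∈ Finset.range (experimentCount ε δ),
        {ω | Successful k (observed r w ω) j}.indicator (fun _ => (1 : ℝ)) ω) /
          (experimentCount ε δ : ℝ) - (P {ω | w k ω = r}).toReal|} := by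
      refine measurableSet_le measurable_const ?_
      have : Measurable fun ω => ∑ j ∈ Finset.range (experimentCount ε δ),
          {ω | Successful k (observed r w ω) j}.indicator (fun _ => (1 : ℝ)) ω :=
        Finset.measurable_fun_sum _ fun j _ => measurable_const.indicator (hA j)
      fun_prop
    have hcompl := probReal_compl_eq_one_sub (μ := P) hmeas
    have hset : {ω | |estimate k (experimentCount ε δ) (observed r w ω) -
        P.real {ω' | w k ω' = r}| < ε} = {ω | ε ≤ |(∑ j ∈ Finset.range (experimentCount ε δ),
        {ω | Successful k (observed r w ω) j}.indicator (fun _ => (1 : ℝ)) ω) /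
          (experimentCount ε δ : ℝ) - (P {ω | w k ω = r}).toReal|}ᶜ := by
      ext ω
      simp only [estimate_eq_sum_indicator k _ (observed r w), Set.mem_ofPred_eq,
        Set.mem_compl_iff, not_le, measureReal_def]
    rw [hset, hcompl]
    linarith [inv_le_of_experimentCount_ne_zero hε hδ hN]

theorem IsSimpleRandomWalk.lintegral_experimentEnd_experimentCount_le
    (hw : IsSimpleRandomWalk G r P w) (hG : G.Connected) (hV : 1 < Fintype.card V) (k : ℕ)
    {ε δ : ℝ} (hδ : 0 < δ) :
    ∫⁻ ω, ((experimentEnd k (observed r w ω) (experimentCount ε δ) : ℕ∞) : ℝ≥0∞) ∂P ≤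
      ENNReal.ofReal (2 * ((k : ℝ) + (Fintype.card V : ℝ) ^ 3) * (ε ^ 2)⁻¹ * δ⁻¹) := by
  refine (hw.lintegral_experimentEnd_le hG hV k _).trans ?_
  rw [← ENNReal.ofReal_natCast k, ← ENNReal.ofReal_natCast (experimentCount ε δ),
    ← ENNReal.ofReal_add (by positivity) (by positivity), ← ENNReal.ofReal_mul (by positivity)]
  refine ENNReal.ofReal_le_ofReal ?_
  calc (experimentCount ε δ : ℝ) * (k + 2 * (Fintype.card V : ℝ) ^ 3)
      ≤ ((ε ^ 2)⁻¹ * δ⁻¹) * (2 * (k + (Fintype.card V : ℝ) ^ 3)) := by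
        refine mul_le_mul (experimentCount_le ε δ hδ) ?_ (by positivity) (by positivity)
        linarith [(Nat.cast_nonneg k : (0 : ℝ) ≤ k)]
    _ = _ := by ring

end Accuracy

end ReturnObservation

open ReturnObservation in
theorem mainTheorem3 :
    ∃ C : ℝ, 0 < C ∧ ∀ (k : ℕ) (ε δ : ℝ), 0 < ε → 0 < δ →
      -- the stopping time and the estimate depend only on what was observed up to that time
      (∀ a a' : ℕ → Bool,
        (∀ t : ℕ, (t : ℕ∞) ≤ experimentEnd k a (experimentCount ε δ) → a t = a' t) →
          experimentEnd k a' (experimentCount ε δ) = experimentEnd k a (experimentCount ε δ) ∧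
          estimate k (experimentCount ε δ) a' = estimate k (experimentCount ε δ) a) ∧
      ∀ (V : Type*) [Fintype V] [DecidableEq V] (G : SimpleGraph V) [DecidableRel G.Adj] (r : V)
        (Ω : Type*) [MeasurableSpace Ω] (P : Measure Ω) [IsProbabilityMeasure P]
        (w : ℕ → Ω → V),
        G.Connected → 1 < Fintype.card V → IsSimpleRandomWalk G r P w →
          -- the experiments are independent, with success probability `P_k(r, r)`
          iIndepSet (fun j : ℕ => {ω | Successful k (observed r w ω) j}) P ∧
          (∀ j : ℕ, P {ω | Successful k (observed r w ω) j} = P {ω | w k ω = r}) ∧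
          -- the expected time
          ∫⁻ ω, ((experimentEnd k (observed r w ω) (experimentCount ε δ) : ℕ∞) : ℝ≥0∞) ∂P ≤
            ENNReal.ofReal (C * ((k : ℝ) + (Fintype.card V : ℝ) ^ 3) * (ε ^ 2)⁻¹ * δ⁻¹) ∧
          -- the accuracy of the estimate
          1 - δ ≤ P.real {ω |
            |estimate k (experimentCount ε δ) (observed r w ω) - P.real {ω' | w k ω' = r}| < ε}
      := by
  -- The constant comes from `k + 2 n³ ≤ 2 (k + n³)`.
  refine ⟨2, two_pos, fun k ε δ hε hδ => ⟨fun a a' h => ?_, ?_⟩⟩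
  · exact ⟨experimentEnd_congr h le_rfl, estimate_congr h⟩
  · intro V _ _ G _ r Ω _ P _ w hG hV hw
    exact ⟨hw.iIndepSet_successful hG hV k, hw.measure_successful hG hV k,
      hw.lintegral_experimentEnd_experimentCount_le hG hV k hδ,
      hw.one_sub_le_measureReal_estimate hG hV k hε hδ⟩
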